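/- Let $G$ be a countable discrete group. An action of $G$ by homeomorphisms on a nonempty compact Hausdorff space $X$ is a boundary action if it is minimal and if, for every regular Borel probability measure $\nu$ on $X$, the weak* closure of the orbit $\{g_*\nu \mid g\in G\}$ contains a point measure; it is topologically free if, for every $g\in G\setminus\{e\}$, the set $\{x\in X\mid gx=x\}$ has empty interior. A subgroup $H$ of $G$ is weakly parabolic if there is a topologically free boundary action of $G$ on some $X$ such that $X$ carries an $H$-invariant regular Borel probability measure. For a unitary representation $\pi$ of $G$ on a Hilbert space $\mathcal H$, let $C^*_\pi(G)$ be the norm closure of the linear span of $\pi(G)$ in $\mathcal B(\mathcal H)$; let $\lambda_G$ be the left regular representation on $\ell^2(G)$ and $C^*_{\rm red}(G)=C^*_{\lambda_G}(G)$. For a unitary representation $\sigma$ of $H$ on a Hilbert space $\mathcal K$, the induced representation $\operatorname{Ind}_H^G\sigma$ acts by left translation $(\pi(g)F)(x)=F(g^{-1}x)$ on the Hilbert space of maps $F:G\to\mathcal K$ with $F(xh)=\sigma(h^{-1})F(x)$ for $x\in G$, $h\in H$ and $\sum_{x\in G/H}\|F(x)\|^2<\infty$. Theorem. Let $H$ be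 a weakly parabolic subgroup of $G$, let $\sigma$ be a unitary representation of $H$ on a nonzero Hilbert space, and let $\pi=\operatorname{Ind}_H^G\sigma$. Then the map $\pi(g)\mapsto\lambda_G(g)$, $g\in G$, extends to a surjective $*$-homomorphism $C^*_\pi(G)\to C^*_{\rm red}(G)$, and its kernel is the (unique) largest proper closed two-sided ideal of $C^*_\pi(G)$: it is a proper closed two-sided ideal and contains every proper closed two-sided ideal of $C^*_\pi(G)$. -/

import Mathlib

open MeasureTheory
open scoped InnerProductSpace

universe u v w

noncomputable section

namespace IndRep

/-! ### Unitary representations and their C*-algebras -/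

/-- Unitary representations of a (discrete) group `G` on a complex Hilbert space `E`. -/
abbrev UnitaryRep (G : Type u) [Group G] (E : Type w) [NormedAddCommGroup E]
    [InnerProductSpace ℂ E] [CompleteSpace E] : Type (max u w) :=
  G →* unitary (E →L[ℂ] E)

section CStar

variable {G : Type u} [Group G] {E : Type w} [NormedAddCommGroup E]
  [InnerProductSpace ℂ E] [CompleteSpace E]

/-- A group homomorphism into the linear isometries of `E` is a unitary representation: the
isometry `T g` is invertible with inverse `T g⁻¹`. -/
def UnitaryRep.ofIsometries (T : G →* (E →ₗᵢ[ℂ] E)) : UnitaryRep G E :=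
  (Unitary.linearIsometryEquiv (𝕜 := ℂ) (H := E)).symm.toMonoidHom.comp
    { toFun := fun g =>
        { (T g) with
          invFun := T g⁻¹
          left_inv := fun x => by
            change (T g⁻¹ * T g) x = x
            rw [← map_mul]; simp
          right_inv := fun x => by
            change (T g * T g⁻¹) x = x
            rw [← map_mul]; simp }
      map_one' := by
        ext x
        change T 1 x = x
        simp
      map_mul' := fun g h => by
        ext x
        change T (g * h) x = (T g * T h) x
        rw [map_mul] }

theorem UnitaryRep.ofIsometries_apply (T : G →* (E →ₗᵢ[ℂ] E)) (g : G) (x : E) :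
    ((UnitaryRep.ofIsometries T g : unitary (E →L[ℂ] E)) : E →L[ℂ] E) x = T g x := rfl

/-- The extension of a unitary representation `π` to the group algebra,
`π(f) = ∑ f(s) π(s)`. -/
def UnitaryRep.onGroupAlgebra (π : UnitaryRep G E) :
    MonoidAlgebra ℂ G →ₐ[ℂ] (E →L[ℂ] E) :=
  MonoidAlgebra.lift ℂ (E →L[ℂ] E) G ((unitary (E →L[ℂ] E)).subtype.comp π)

theorem UnitaryRep.onGroupAlgebra_single (π : UnitaryRep G E) (g : G) (c : ℂ) :
    π.onGroupAlgebra (MonoidAlgebra.single g c) = c • (π g : E →L[ℂ] E) := by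
  simp [UnitaryRep.onGroupAlgebra]

theorem UnitaryRep.star_onGroupAlgebra_mem (π : UnitaryRep G E) (f : MonoidAlgebra ℂ G) :
    star (π.onGroupAlgebra f) ∈ π.onGroupAlgebra.range := by
  induction f using MonoidAlgebra.induction_linear with
  | zero => simp
  | add f₁ f₂ h₁ h₂ => rw [map_add, star_add]; exact add_mem h₁ h₂
  | single g c =>
    refine ⟨MonoidAlgebra.single g⁻¹ (star c), ?_⟩
    change π.onGroupAlgebra (MonoidAlgebra.single g⁻¹ (star c)) = _
    rw [π.onGroupAlgebra_single, π.onGroupAlgebra_single, star_smul, map_inv,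
      ← Unitary.star_eq_inv, Unitary.coe_star]

/-- The `*`-algebra `{π(f) | f ∈ ℂ[G]}` of operators on `E`. -/
def UnitaryRep.groupStarAlgebra (π : UnitaryRep G E) : StarSubalgebra ℂ (E →L[ℂ] E) :=
  { π.onGroupAlgebra.range with
    star_mem' := by
      rintro _ ⟨f, rfl⟩
      exact π.star_onGroupAlgebra_mem f }

/-- `C*_π(G)`: the norm closure of `{π(f) | f ∈ ℂ[G]}` in the bounded operators on `E`. -/
def UnitaryRep.cstar (π : UnitaryRep G E) : StarSubalgebra ℂ (E →L[ℂ] E) :=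
  π.groupStarAlgebra.topologicalClosure

theorem UnitaryRep.mem_cstar (π : UnitaryRep G E) (g : G) :
    (π g : E →L[ℂ] E) ∈ π.cstar :=
  StarSubalgebra.le_topologicalClosure _
    ⟨MonoidAlgebra.single g 1, (π.onGroupAlgebra_single g 1).trans (one_smul _ _)⟩

/-- The operator `π(g)` as an element of `C*_π(G)`. -/
def UnitaryRep.toCstar (π : UnitaryRep G E) (g : G) : π.cstar :=
  ⟨(π g : E →L[ℂ] E), π.mem_cstar g⟩

end CStar

/-! ### The regular representation -/

section Regular

variable (G : Type u) [Group G]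

/-- Left translation on `ℓ²(G)`: `(λ(g) f)(x) = f(g⁻¹ x)`. -/
def leftTranslation : G →* (lp (fun _ : G => ℂ) 2 →ₗᵢ[ℂ] lp (fun _ : G => ℂ) 2) where
  toFun g :=
    { toFun := fun f => ⟨fun x => f (g⁻¹ * x), by
        have h := lp.memℓp f
        rw [memℓp_gen_iff (by norm_num)] at h
        exact (memℓp_gen_iff (by norm_num)).mpr ((Equiv.mulLeft g⁻¹).summable_iff.mpr h)⟩
      map_add' := fun _ _ => rfl
      map_smul' := fun _ _ => rfl
      norm_map' := fun f => by
        rw [lp.norm_eq_tsum_rpow (by norm_num), lp.norm_eq_tsum_rpow (by norm_num)]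
        congr 1
        exact (Equiv.mulLeft g⁻¹).tsum_eq fun x => ‖f x‖ ^ (2 : ENNReal).toReal }
  map_one' := by
    ext f x
    change f (1⁻¹ * x) = f x
    simp
  map_mul' g h := by
    ext f x
    change f ((g * h)⁻¹ * x) = f (h⁻¹ * (g⁻¹ * x))
    rw [mul_inv_rev, mul_assoc]

/-- The left regular representation `λ_G` on `ℓ²(G)`. -/
def regularRep : UnitaryRep G (lp (fun _ : G => ℂ) 2) :=
  UnitaryRep.ofIsometries (leftTranslation G)

end Regular

/-! ### Induced representations -/

section Induced

variable {G : Type u} [Group G] {H : Subgroup G} {K : Type w} [NormedAddCommGroup K]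
  [InnerProductSpace ℂ K] [CompleteSpace K] (σ : UnitaryRep H K)

/-- The maps `F : G → K` with `F(xh) = σ(h⁻¹) F(x)` and `∑_{x ∈ G/H} ‖F(x)‖² < ∞`. The
equivariance makes `‖F(x)‖` depend on the coset `xH` only, so that the sum may be taken over any
system of representatives; `Quotient.out` chooses one. -/
def indSubmodule : Submodule ℂ (G → K) where
  carrier := {F | (∀ (x : G) (h : H), F (x * h) = (σ h⁻¹ : K →L[ℂ] K) (F x)) ∧
    Summable fun c : G ⧸ H => ‖F c.out‖ ^ 2}
  zero_mem' := by simp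
  add_mem' := by
    rintro F₁ F₂ ⟨h₁, s₁⟩ ⟨h₂, s₂⟩
    refine ⟨fun x h => by simp [h₁, h₂], ?_⟩
    refine Summable.of_nonneg_of_le (fun _ => by positivity) (fun c => ?_)
      ((s₁.add s₂).mul_left 2)
    have h := norm_add_le (F₁ c.out) (F₂ c.out)
    have h0 := norm_nonneg (F₁ c.out + F₂ c.out)
    simp only [Pi.add_apply]
    nlinarith [sq_nonneg (‖F₁ c.out‖ - ‖F₂ c.out‖)]
  smul_mem' := by
    rintro a F ⟨h, s⟩
    refine ⟨fun x k => by simp [h], ?_⟩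
    simpa [norm_smul, mul_pow] using s.mul_left (‖a‖ ^ 2)

/-- The Hilbert space of `Ind_H^G σ`. (A type of its own, so that it does not inherit the product
topology of `G → K`.) -/
def IndSpace : Type (max u w) := indSubmodule σ

namespace IndSpace

instance : AddCommGroup (IndSpace σ) := inferInstanceAs (AddCommGroup (indSubmodule σ))

instance : Module ℂ (IndSpace σ) := inferInstanceAs (Module ℂ (indSubmodule σ))

variable {σ}

/-- The map `F : G → K` underlying an element of the space of `Ind_H^G σ`. -/
def toFun (F : IndSpace σ) : G → K := F.1

instance : CoeFun (IndSpace σ) (fun _ => G → K) := ⟨toFun⟩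

theorem ext {F₁ F₂ : IndSpace σ} (h : ∀ x, F₁ x = F₂ x) : F₁ = F₂ :=
  Subtype.ext (funext h)

theorem map_mul_right (F : IndSpace σ) (x : G) (h : H) :
    F (x * h) = (σ h⁻¹ : K →L[ℂ] K) (F x) := F.2.1 x h

theorem norm_mul_right (F : IndSpace σ) (x : G) (h : H) : ‖F (x * h)‖ = ‖F x‖ := by
  rw [F.map_mul_right]; exact Unitary.norm_map (σ h⁻¹) (F x)

theorem norm_out (F : IndSpace σ) (x : G) : ‖F (x : G ⧸ H).out‖ = ‖F x‖ := by
  obtain ⟨h, hh⟩ := QuotientGroup.mk_out_eq_mul H x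
  rw [hh, F.norm_mul_right]

variable (σ) in
/-- Restriction to the chosen representatives identifies the space of `Ind_H^G σ` with
`ℓ²(G/H, K)`. -/
def toLp : IndSpace σ →ₗ[ℂ] lp (fun _ : G ⧸ H => K) 2 where
  toFun F := ⟨fun c => F c.out, by
    refine (memℓp_gen_iff (by norm_num)).mpr ?_
    have h : Summable fun c : G ⧸ H => ‖F c.out‖ ^ 2 := F.2.2
    simpa using h⟩
  map_add' _ _ := rfl
  map_smul' _ _ := rfl

theorem toLp_apply (F : IndSpace σ) (c : G ⧸ H) : toLp σ F c = F c.out := rfl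

theorem toLp_injective : Function.Injective (toLp σ) := by
  intro F₁ F₂ h
  refine ext fun x => ?_
  obtain ⟨k, hk⟩ := QuotientGroup.mk_out_eq_mul H x
  have hx : x = (x : G ⧸ H).out * ((k⁻¹ : H) : G) := by rw [hk]; simp
  rw [hx, F₁.map_mul_right, F₂.map_mul_right, ← toLp_apply, ← toLp_apply, h]

theorem toLp_surjective : Function.Surjective (toLp σ) := by
  intro f
  have key : ∀ x : G, x⁻¹ * (x : G ⧸ H).out ∈ H := fun x => by
    rw [← QuotientGroup.eq, QuotientGroup.out_eq']
  have hout : ∀ c : G ⧸ H, (⟨_, key c.out⟩ : H) = 1 := fun c => by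
    ext
    simp
  refine ⟨⟨fun x => (σ ⟨_, key x⟩ : K →L[ℂ] K) (f x), ?_, ?_⟩, ?_⟩
  · intro x h
    have e : (⟨_, key (x * h)⟩ : H) = h⁻¹ * ⟨_, key x⟩ := by
      ext
      simp [mul_assoc]
    have e' : ((x * h : G) : G ⧸ H) = x := by simp
    change (σ ⟨_, key (x * h)⟩ : K →L[ℂ] K) (f ((x * h : G) : G ⧸ H)) =
      (σ h⁻¹ : K →L[ℂ] K) ((σ ⟨_, key x⟩ : K →L[ℂ] K) (f x))
    rw [e, map_mul, e']
    rfl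
  · have h := lp.memℓp f
    rw [memℓp_gen_iff (by norm_num)] at h
    refine h.congr fun c => ?_
    change _ = ‖(σ ⟨_, key c.out⟩ : K →L[ℂ] K) (f (c.out : G ⧸ H))‖ ^ 2
    rw [hout, map_one, QuotientGroup.out_eq']
    simp
  · ext c
    change (σ ⟨_, key c.out⟩ : K →L[ℂ] K) (f (c.out : G ⧸ H)) = f c
    rw [hout, map_one, QuotientGroup.out_eq']
    simp

/-- The inner product `⟪F₁, F₂⟫ = ∑_{x ∈ G/H} ⟪F₁(x), F₂(x)⟫`. -/
instance : Inner ℂ (IndSpace σ) := ⟨fun F₁ F₂ => ∑' c : G ⧸ H, ⟪F₁ c.out, F₂ c.out⟫_ℂ⟩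

theorem inner_def (F₁ F₂ : IndSpace σ) :
    ⟪F₁, F₂⟫_ℂ = ∑' c : G ⧸ H, ⟪F₁ c.out, F₂ c.out⟫_ℂ := rfl

theorem inner_eq_toLp (F₁ F₂ : IndSpace σ) : ⟪F₁, F₂⟫_ℂ = ⟪toLp σ F₁, toLp σ F₂⟫_ℂ :=
  (lp.inner_eq_tsum (𝕜 := ℂ) (toLp σ F₁) (toLp σ F₂)).symm

variable (σ) in
/-- The inner product of the space of `Ind_H^G σ` satisfies the axioms. -/
@[reducible]
def core : InnerProductSpace.Core ℂ (IndSpace σ) where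
  inner F₁ F₂ := ⟪F₁, F₂⟫_ℂ
  conj_inner_symm F₁ F₂ := by rw [inner_eq_toLp, inner_eq_toLp, inner_conj_symm]
  re_inner_nonneg F := by rw [inner_eq_toLp]; exact inner_self_nonneg
  add_left F₁ F₂ F₃ := by simp only [inner_eq_toLp, map_add, inner_add_left]
  smul_left F₁ F₂ a := by simp only [inner_eq_toLp, map_smul, inner_smul_left]
  definite F h := by
    rw [inner_eq_toLp, inner_self_eq_zero] at h
    exact toLp_injective (h.trans (map_zero _).symm)

instance : NormedAddCommGroup (IndSpace σ) := (core σ).toNormedAddCommGroup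

instance : InnerProductSpace ℂ (IndSpace σ) := InnerProductSpace.ofCore (core σ).toCore

theorem norm_toLp (F : IndSpace σ) : ‖toLp σ F‖ = ‖F‖ := by
  rw [norm_eq_sqrt_re_inner (𝕜 := ℂ), norm_eq_sqrt_re_inner (𝕜 := ℂ) F]
  exact congrArg (fun z : ℂ => √(RCLike.re z)) (inner_eq_toLp F F).symm

instance : CompleteSpace (IndSpace σ) := by
  let e : IndSpace σ ≃ₗᵢ[ℂ] lp (fun _ : G ⧸ H => K) 2 :=
    { LinearEquiv.ofBijective (toLp σ) ⟨toLp_injective, toLp_surjective⟩ with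
      norm_map' := norm_toLp }
  exact (completeSpace_congr (e := e.toEquiv) e.isometry.isUniformEmbedding).mpr inferInstance

theorem norm_sq_eq (F : IndSpace σ) : ‖F‖ ^ 2 = ∑' c : G ⧸ H, ‖F c.out‖ ^ 2 := by
  have h := lp.norm_rpow_eq_tsum (p := 2) (by norm_num) (toLp σ F)
  rw [norm_toLp] at h
  simpa [toLp_apply] using h

theorem norm_translate_out (F : IndSpace σ) (g : G) (c : G ⧸ H) :
    ‖F (g⁻¹ * c.out)‖ = ‖F (g⁻¹ • c).out‖ := by
  rw [← F.norm_out (g⁻¹ * c.out)]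
  have : ((g⁻¹ * c.out : G) : G ⧸ H) = g⁻¹ • c := by
    conv_rhs => rw [← QuotientGroup.out_eq' c]
    rfl
  rw [this]

/-- The left translate `x ↦ F(g⁻¹ x)`. -/
def translate (g : G) (F : IndSpace σ) : IndSpace σ :=
  ⟨fun x => F (g⁻¹ * x),
    fun x h => (congrArg F (mul_assoc g⁻¹ x h).symm).trans (F.map_mul_right (g⁻¹ * x) h), by
      have h : Summable fun c : G ⧸ H => ‖F c.out‖ ^ 2 := F.2.2
      have h' := (MulAction.toPerm (α := G) (β := G ⧸ H) g⁻¹).summable_iff.mpr h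
      exact h'.congr fun c => congrArg (· ^ 2) (F.norm_translate_out g c).symm⟩

theorem translate_apply (g : G) (F : IndSpace σ) (x : G) : translate g F x = F (g⁻¹ * x) := rfl

theorem norm_translate (g : G) (F : IndSpace σ) : ‖translate g F‖ = ‖F‖ := by
  rw [← sq_eq_sq₀ (norm_nonneg _) (norm_nonneg _), norm_sq_eq, norm_sq_eq,
    ← (MulAction.toPerm (α := G) (β := G ⧸ H) g⁻¹).tsum_eq fun c : G ⧸ H => ‖F c.out‖ ^ 2]
  exact tsum_congr fun c => congrArg (· ^ 2) (F.norm_translate_out g c)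

variable (σ) in
/-- Left translation on the space of `Ind_H^G σ`: `(π(g) F)(x) = F(g⁻¹ x)`. -/
def translation : G →* (IndSpace σ →ₗᵢ[ℂ] IndSpace σ) where
  toFun g :=
    { toFun := translate g
      map_add' := fun _ _ => rfl
      map_smul' := fun _ _ => rfl
      norm_map' := norm_translate g }
  map_one' := by
    refine LinearIsometry.ext fun F => ext fun x => ?_
    change F (1⁻¹ * x) = F x
    rw [inv_one, one_mul]
  map_mul' g h := by
    refine LinearIsometry.ext fun F => ext fun x => ?_
    change F ((g * h)⁻¹ * x) = F (h⁻¹ * (g⁻¹ * x))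
    rw [mul_inv_rev, mul_assoc]

end IndSpace

/-- The induced representation `Ind_H^G σ`. -/
def inducedRep : UnitaryRep G (IndSpace σ) :=
  UnitaryRep.ofIsometries (IndSpace.translation σ)

end Induced

/-! ### Boundary actions and weakly parabolic subgroups -/

section Boundary

variable (G : Type u) [Group G] (X : Type v) [TopologicalSpace X] [MeasurableSpace X]
  [BorelSpace X] [MulAction G X] [ContinuousConstSMul G X]

variable {G X} in
/-- The image `g_*ν` of a Borel probability measure under `x ↦ gx`. -/
def pushforward (g : G) (ν : ProbabilityMeasure X) : ProbabilityMeasure X :=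
  ν.map (continuous_const_smul g).measurable.aemeasurable

/-- Strong proximality: for every (regular Borel) probability measure `ν`, the weak* closure of the
orbit `Gν` contains a point measure. The topology on `ProbabilityMeasure X` is that of convergence
of integrals of bounded continuous functions. -/
def IsStronglyProximal : Prop :=
  ∀ ν : ProbabilityMeasure X, (ν : Measure X).Regular →
    ∃ x : X, diracProba x ∈ closure (Set.range fun g : G => pushforward g ν)

/-- Boundary actions (on a nonempty compact Hausdorff space): minimal and strongly proximal. -/
structure IsBoundaryAction : Prop where
  nonempty : Nonempty X
  minimal : MulAction.IsMinimal G X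
  stronglyProximal : IsStronglyProximal G X

/-- The fixed point set of every `g ≠ 1` has empty interior. -/
def IsTopologicallyFree (G : Type u) [Group G] (X : Type v) [TopologicalSpace X]
    [MulAction G X] : Prop :=
  ∀ g : G, g ≠ 1 → interior (MulAction.fixedBy X g) = ∅

end Boundary

/-- `H` is weakly parabolic in `G`: it fixes a (regular Borel) probability measure on a compact
Hausdorff space `X` with a topologically free boundary action of `G`. -/
def IsWeaklyParabolic {G : Type u} [Group G] (H : Subgroup G) : Prop :=
  ∃ (X : Type v) (_ : TopologicalSpace X) (_ : CompactSpace X) (_ : T2Space X)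
    (_ : MeasurableSpace X) (_ : BorelSpace X) (_ : MulAction G X)
    (_ : ContinuousConstSMul G X),
    IsBoundaryAction G X ∧ IsTopologicallyFree G X ∧
      ∃ ν : ProbabilityMeasure X, (ν : Measure X).Regular ∧ ∀ h ∈ H, pushforward h ν = ν

end IndRep

end

noncomputable section

namespace IndRep

/-! Write `E` for the space of `π = Ind σ` and let `ν` be an `H`-invariant measure on a
topologically free boundary `X`. Since `ν` is `H`-invariant, the Poisson transform `x ↦ ∫ f(xy)
dν(y)` is constant on cosets `xH`, so multiplication by it is an operator `θ(f)` on `E`. The map `θ`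
is unital, positive and covariant for `π` (`isCovariant_poissonOp`); it need not be multiplicative,
but `θ(f)² ≤ θ(f)` when `0 ≤ f ≤ 1`, and this is enough.

Let `I` be a proper ideal of `C*_π(G)`. Hahn-Banach gives a state `φ` of all of `B(E)` that vanishes
on `I` (`exists_isState_of_isProper`), and `φ ∘ θ` is a probability measure `μ` on `X`. Conjugating
`φ` by `π(g)` replaces `μ` by `g_*μ` and keeps `I` in the kernel. As every point mass lies in the
weak* closure of the orbit of `μ`, a weak* limit of conjugates is a state `ψ` that still vanishes on
`I` and satisfies `ψ ∘ θ = ev_x`, for any prescribed `x` (`IsCovariant.exists_isState_eval`). By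
Baire, `x` can be chosen with trivial stabilizer. Cauchy-Schwarz and covariance then force `ψ(π(g))
= 0` for `g ≠ 1` (`IsCovariant.isTraceOn`).

So every proper ideal is killed by a state restricting to the canonical trace, whose GNS
representation is `λ_G`. The zero ideal yields `‖λ(f)‖ ≤ ‖π(f)‖`, hence the homomorphism; a general
`I` is seen to lie in its kernel (`IsTraceOn.map_eq_zero`). -/

/-! ### States -/

section States

variable {B : Type*} [CStarAlgebra B]

/-- States of a unital C*-algebra, as contractive unital functionals. -/
structure IsState (φ : StrongDual ℂ B) : Prop where
  norm_le : ‖φ‖ ≤ 1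
  map_one : φ 1 = 1

namespace IsState

variable {φ : StrongDual ℂ B}

theorem norm_apply_le (hφ : IsState φ) (b : B) : ‖φ b‖ ≤ ‖b‖ :=
  (φ.le_of_opNorm_le hφ.norm_le b).trans_eq (one_mul _)

/-- Allows positivity under a state to be deduced from a norm bound, with no order on `B`; the
conditions in `IsCovariant` are phrased for this use. -/
theorem re_nonneg_of_norm_one_sub_le (hφ : IsState φ) {b : B} (hb : ‖1 - b‖ ≤ 1) :
    0 ≤ (φ b).re := by
  have h := (Complex.re_le_norm _).trans ((hφ.norm_apply_le (1 - b)).trans hb)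
  rw [map_sub, hφ.map_one] at h
  simpa using h

/-- Shifting `a` by `it` raises `‖a‖²` by at most `t²`, while the imaginary part of the value moves
by `t`; the cross term `2t·Im φ(a)` would break the bound for suitable `t` unless it vanishes. -/
theorem im_eq_zero (hφ : IsState φ) {a : B} (ha : IsSelfAdjoint a) : (φ a).im = 0 := by
  have key : ∀ t : ℝ, ((φ a).im + t) ^ 2 ≤ ‖a‖ ^ 2 + t ^ 2 := by
    intro t
    have h1 : ‖a + (t * Complex.I : ℂ) • (1 : B)‖ ^ 2 ≤ ‖a‖ ^ 2 + t ^ 2 := by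
      have e : star (a + (t * Complex.I : ℂ) • (1 : B)) * (a + (t * Complex.I : ℂ) • (1 : B))
          = star a * a + ((t ^ 2 : ℝ) : ℂ) • (1 : B) := by
        have h2 : ((t * Complex.I : ℂ) * (t * Complex.I)) = -((t ^ 2 : ℝ) : ℂ) := by
          push_cast; linear_combination (t : ℂ) ^ 2 * Complex.I_mul_I
        simp only [star_add, star_smul, star_one, ha.star_eq, add_mul, mul_add, smul_mul_assoc,
          mul_smul_comm, one_mul, mul_one]
        simp only [Complex.star_def, map_mul, Complex.conj_ofReal, Complex.conj_I, mul_neg,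
          neg_smul]
        rw [smul_add, smul_neg, smul_smul, h2, neg_smul]
        abel
      rw [sq, ← CStarRing.norm_star_mul_self, e]
      refine (norm_add_le _ _).trans (add_le_add ?_ ?_)
      · rw [CStarRing.norm_star_mul_self, sq]
      · rcases subsingleton_or_nontrivial B with h | h
        · rw [Subsingleton.elim (((t ^ 2 : ℝ) : ℂ) • (1 : B)) 0, norm_zero]; positivity
        · rw [norm_smul, norm_one, mul_one, Complex.norm_real, Real.norm_of_nonneg (by positivity)]
    have h3 := hφ.norm_apply_le (a + (t * Complex.I : ℂ) • (1 : B))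
    have h4 := (Complex.abs_im_le_norm _).trans h3
    rw [map_add, map_smul, hφ.map_one] at h4
    have h5 := pow_le_pow_left₀ (abs_nonneg _) h4 2
    rw [sq_abs] at h5
    simpa using h5.trans h1
  by_contra hne
  -- This `t` makes the cross term equal to `‖a‖² + 1`, more than the bound allows.
  have h := key ((‖a‖ ^ 2 + 1) / (2 * (φ a).im))
  have h6 : 2 * (φ a).im * ((‖a‖ ^ 2 + 1) / (2 * (φ a).im)) = ‖a‖ ^ 2 + 1 := by
    field_simp
  nlinarith [sq_nonneg (φ a).im]

theorem map_star (hφ : IsState φ) (b : B) : φ (star b) = star (φ b) := by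
  have h1 := hφ.im_eq_zero (IsSelfAdjoint.add_star_self b)
  have h2 := hφ.im_eq_zero (a := Complex.I • (b - star b)) (by
    rw [isSelfAdjoint_iff, star_smul, star_sub, star_star, Complex.star_def, Complex.conj_I,
      neg_smul, ← smul_neg, neg_sub])
  rw [map_add, Complex.add_im] at h1
  rw [map_smul, map_sub, smul_eq_mul, Complex.I_mul_im, Complex.sub_re] at h2
  apply Complex.ext
  · simp only [Complex.star_def, Complex.conj_re]; linarith
  · simp only [Complex.star_def, Complex.conj_im]; linarith

variable [PartialOrder B] [StarOrderedRing B]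

theorem re_nonneg (hφ : IsState φ) {b : B} (hb : 0 ≤ b) : 0 ≤ (φ b).re := by
  rcases eq_or_ne b 0 with rfl | hne
  · simp
  have hpos : 0 < ‖b‖ := norm_pos_iff.mpr hne
  set c : B := (‖b‖⁻¹ : ℝ) • b with hc
  have hc0 : 0 ≤ c := smul_nonneg (by positivity) hb
  have hc1 : ‖c‖ ≤ 1 := by
    rw [hc, norm_smul, norm_inv, norm_norm, inv_mul_cancel₀ hpos.ne']
  have hle : c ≤ 1 := (CStarAlgebra.norm_le_one_iff_of_nonneg c hc0).mp hc1
  have h := hφ.re_nonneg_of_norm_one_sub_le (b := c)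
    ((CStarAlgebra.norm_le_one_iff_of_nonneg (1 - c) (sub_nonneg.mpr hle)).mpr
      (sub_le_self _ hc0))
  rw [hc, ← Complex.coe_smul, map_smul, smul_eq_mul, Complex.re_ofReal_mul] at h
  exact nonneg_of_mul_nonneg_right h (by positivity)

theorem re_mono (hφ : IsState φ) {b c : B} (h : b ≤ c) : (φ b).re ≤ (φ c).re := by
  have := hφ.re_nonneg (sub_nonneg.mpr h)
  rw [map_sub, Complex.sub_re] at this
  linarith

/-- The inequality making left multiplication by `a` bounded by `‖a‖` in the GNS seminorm; it comes
from `a*a ≤ ‖a‖²`, conjugated by `k`. -/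
theorem re_star_conj_le (hφ : IsState φ) (a k : B) :
    (φ (star k * (star a * a) * k)).re ≤ ‖a‖ ^ 2 * (φ (star k * k)).re := by
  have h := hφ.re_mono (CStarAlgebra.star_left_conjugate_le_norm_smul
    (a := k) (b := star a * a) (hb := by cfc_tac))
  rwa [CStarRing.norm_star_mul_self, ← sq, ← Complex.coe_smul, map_smul, smul_eq_mul,
    Complex.re_ofReal_mul] at h

/-- The Cauchy-Schwarz inequality. -/
theorem norm_star_mul_sq_le (hφ : IsState φ) (a b : B) :
    ‖φ (star a * b)‖ ^ 2 ≤ (φ (star a * a)).re * (φ (star b * b)).re := by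
  let core : PreInnerProductSpace.Core ℂ B :=
    { inner := fun a b => φ (star a * b)
      conj_inner_symm := fun a b => by
        change star (φ (star b * a)) = φ (star a * b)
        rw [← hφ.map_star, star_mul, star_star]
      re_inner_nonneg := fun a => hφ.re_nonneg (star_mul_self_nonneg a)
      add_left := fun a b c => by
        change φ (star (a + b) * c) = φ (star a * c) + φ (star b * c)
        rw [star_add, add_mul, map_add]
      smul_left := fun a b r => by
        change φ (star (r • a) * b) = star r * φ (star a * b)
        rw [star_smul, smul_mul_assoc, map_smul, smul_eq_mul] }
  have h := @InnerProductSpace.Core.inner_mul_inner_self_le ℂ B _ _ _ core a b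
  have e : φ (star b * a) = star (φ (star a * b)) := by
    rw [← hφ.map_star, star_mul, star_star]
  change ‖φ (star a * b)‖ * ‖φ (star b * a)‖ ≤ (φ (star a * a)).re * (φ (star b * b)).re at h
  rw [e, norm_star] at h
  rwa [sq]

theorem map_mul_eq_zero_left (hφ : IsState φ) {a : B} (ha : (φ (a * star a)).re ≤ 0) (b : B) :
    φ (a * b) = 0 := by
  have h := hφ.norm_star_mul_sq_le (star a) b
  rw [star_star] at h
  have h2 := hφ.re_nonneg (star_mul_self_nonneg b)
  have h3 : ‖φ (a * b)‖ ^ 2 ≤ 0 := h.trans (mul_nonpos_of_nonpos_of_nonneg ha h2)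
  have h4 : ‖φ (a * b)‖ = 0 := pow_eq_zero_iff two_ne_zero |>.mp (le_antisymm h3 (sq_nonneg _))
  exact norm_eq_zero.mp h4

theorem map_mul_eq_zero_right (hφ : IsState φ) {a : B} (ha : (φ (star a * a)).re ≤ 0) (b : B) :
    φ (b * a) = 0 := by
  have h := hφ.map_mul_eq_zero_left (a := star a) (by rwa [star_star]) (star b)
  rw [← star_mul, hφ.map_star] at h
  exact star_eq_zero.mp h

end IsState

/-- A proper ideal of a C*-subalgebra is annihilated by a state of the whole algebra. -/
theorem exists_isState_of_isProper (A : StarSubalgebra ℂ B) (hA : IsClosed (A : Set B))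
    (I : TwoSidedIdeal A) (hI : I ≠ ⊤) :
    ∃ φ : StrongDual ℂ B, IsState φ ∧ ∀ a ∈ I, φ (a : B) = 0 := by
  have : IsClosed (A : Set B) := hA
  have : CompleteSpace A := hA.completeSpace_coe
  -- An element at distance less than `1` from the unit is invertible in `A`, which a proper ideal
  -- excludes.
  have hdist : ∀ a ∈ I, 1 ≤ ‖(1 : B) - a‖ := by
    intro a ha
    by_contra! hlt
    have hu : IsUnit a := by
      have h := isUnit_one_sub_of_norm_lt_one (R := A) (x := 1 - a) hlt
      rwa [sub_sub_cancel] at h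
    obtain ⟨b, hb⟩ := hu.exists_left_inv
    exact hI ((I.one_mem_iff).mp (hb ▸ I.mul_mem_left b a ha))
  -- The ideal as a subspace of `B`: the functional must be defined on all of `B`, since it will be
  -- evaluated at operators that need not lie in `A`.
  let S : Submodule ℂ B :=
    { carrier := {b | ∃ a ∈ I, (a : B) = b}
      zero_mem' := ⟨0, I.zero_mem, rfl⟩
      add_mem' := by
        rintro _ _ ⟨a, ha, rfl⟩ ⟨b, hb, rfl⟩
        exact ⟨a + b, I.add_mem ha hb, rfl⟩
      smul_mem' := by
        rintro c _ ⟨a, ha, rfl⟩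
        refine ⟨c • a, ?_, rfl⟩
        rw [← one_mul a, ← smul_mul_assoc]
        exact I.mul_mem_left _ _ ha }
  have hn : 1 ≤ ‖(S.mkQ 1 : B ⧸ S)‖ := by
    refine QuotientAddGroup.le_norm_iff.mpr fun m hm => ?_
    obtain ⟨a, ha, hab⟩ := (Submodule.Quotient.eq S).mp hm.symm
    have h := hdist a ha
    rwa [hab, sub_sub_cancel] at h
  have hn' : ‖(S.mkQ 1 : B ⧸ S)‖ = 1 := by
    refine le_antisymm ((Submodule.Quotient.norm_mk_le S 1).trans ?_) hn
    have : Nontrivial B := by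
      refine ⟨1, 0, fun h => ?_⟩
      have h1 := hdist 0 I.zero_mem
      rw [h] at h1
      norm_num at h1
    exact CStarRing.norm_one.le
  -- The class of `1` has norm `1` in `B ⧸ S`, so a norming functional for it pulls back to a state.
  obtain ⟨g, hg1, hg2⟩ := exists_dual_vector'' ℂ (S.mkQ 1 : B ⧸ S)
  have hbound : ∀ b : B, ‖(g.toLinearMap ∘ₗ S.mkQ) b‖ ≤ 1 * ‖b‖ := fun b =>
    (g.le_of_opNorm_le hg1 _).trans
      (mul_le_mul_of_nonneg_left (Submodule.Quotient.norm_mk_le S b) zero_le_one)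
  refine ⟨(g.toLinearMap ∘ₗ S.mkQ).mkContinuous 1 hbound,
    ⟨LinearMap.mkContinuous_norm_le _ zero_le_one _, ?_⟩, fun a ha => ?_⟩
  · change g (S.mkQ 1) = 1
    rw [hg2, hn']; exact Complex.ofReal_one
  · change g (S.mkQ a) = 0
    rw [Submodule.mkQ_apply, (Submodule.Quotient.mk_eq_zero S).mpr ⟨a, ha, rfl⟩, map_zero]

end States

/-! ### The range of a `*`-homomorphism -/

section Range

variable {A B : Type*} [CStarAlgebra A] [CStarAlgebra B]

theorem continuous_starAlgHom (Φ : A →⋆ₐ[ℂ] B) : Continuous Φ :=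
  AddMonoidHomClass.continuous_of_bound Φ 1 fun a => by
    rw [one_mul]; exact NonUnitalStarAlgHom.norm_apply_le Φ a

/-- Self-adjoint elements of the image of a `*`-homomorphism lift without increase of norm. -/
theorem exists_lift_norm_le_of_isSelfAdjoint (Φ : A →⋆ₐ[ℂ] B) {a : A} (ha : IsSelfAdjoint a) :
    ∃ a' : A, Φ a' = Φ a ∧ ‖a'‖ ≤ ‖Φ a‖ := by
  rcases subsingleton_or_nontrivial B with hB | hB
  · exact ⟨0, Subsingleton.elim _ _, by simp⟩
  -- Truncation at `±‖Φ a‖`: it bounds the norm of `f(a)` and is the identity on the spectrum of `Φ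
  -- a`.
  let f : ℝ → ℝ := fun t => max (-‖Φ a‖) (min t ‖Φ a‖)
  have hf : Continuous f := by fun_prop
  have hb : IsSelfAdjoint (Φ a) := ha.map Φ
  refine ⟨cfc f a, ?_, ?_⟩
  · rw [StarAlgHom.map_cfc Φ f a hf.continuousOn (continuous_starAlgHom Φ) ha hb]
    conv_rhs => rw [← cfc_id' ℝ (Φ a)]
    refine cfc_congr fun t ht => ?_
    have h := abs_le.mp (spectrum.norm_le_norm_of_mem ht)
    simp only [f]
    rw [min_eq_left h.2, max_eq_right h.1]
  · refine norm_cfc_le (norm_nonneg _) fun t _ => ?_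
    rw [Real.norm_eq_abs, abs_le]
    exact ⟨le_max_left _ _, max_le (by linarith [norm_nonneg (Φ a)]) (min_le_right _ _)⟩

theorem exists_lift_norm_le (Φ : A →⋆ₐ[ℂ] B) (a : A) :
    ∃ a' : A, Φ a' = Φ a ∧ ‖a'‖ ≤ 2 * ‖Φ a‖ := by
  obtain ⟨x, hx, hxn⟩ := exists_lift_norm_le_of_isSelfAdjoint Φ (realPart a).2
  obtain ⟨y, hy, hyn⟩ := exists_lift_norm_le_of_isSelfAdjoint Φ (imaginaryPart a).2
  have hre : ‖Φ (realPart a : A)‖ ≤ ‖Φ a‖ := by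
    have : Φ (realPart a : A) = (realPart (Φ a) : B) := by
      simp [realPart_apply_coe, ← Complex.coe_smul, map_smul, map_star Φ a]
    rw [this]
    exact realPart.norm_le (Φ a)
  have him : ‖Φ (imaginaryPart a : A)‖ ≤ ‖Φ a‖ := by
    have : Φ (imaginaryPart a : A) = (imaginaryPart (Φ a) : B) := by
      simp [imaginaryPart_apply_coe, ← Complex.coe_smul, map_smul, map_star Φ a]
    rw [this]
    exact imaginaryPart.norm_le (Φ a)
  refine ⟨x + Complex.I • y, ?_, ?_⟩
  · rw [map_add, map_smul, hx, hy, ← map_smul, ← map_add, realPart_add_I_smul_imaginaryPart]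
  · refine (norm_add_le _ _).trans ?_
    rw [norm_smul, Complex.norm_I, one_mul]
    linarith

/-- Lifts with controlled norm make successive approximation converge in the complete algebra `A`,
so the range already contains its closure. -/
theorem surjective_of_denseRange (Φ : A →⋆ₐ[ℂ] B) (hΦ : DenseRange Φ) :
    Function.Surjective Φ := by
  let f : NormedAddGroupHom A B :=
    { toFun := Φ
      map_add' := map_add Φ
      bound' := ⟨1, fun a => by rw [one_mul]; exact NonUnitalStarAlgHom.norm_apply_le Φ a⟩ }
  let j : NormedAddGroupHom f.range B := NormedAddGroupHom.incl f.range
  have h := controlled_closure_range_of_complete (f := f) (j := j) (fun _ => rfl)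
    (C := 2) (ε := 1) two_pos one_pos (by
      rintro ⟨_, a, rfl⟩
      exact exists_lift_norm_le Φ a)
  intro b
  obtain ⟨a, ha, -⟩ := h b (by
    refine closure_mono ?_ (hΦ b)
    rintro _ ⟨a, rfl⟩
    exact ⟨⟨Φ a, a, rfl⟩, rfl⟩)
  exact ⟨a, ha⟩

/-- A homomorphism dominated in norm by another one with dense range factors through it. -/
theorem exists_starAlgHom_of_norm_le {R : Type*} [Ring R] [Algebra ℂ R] (e : R →ₐ[ℂ] A)
    (r : R →ₐ[ℂ] B) (he : DenseRange e) (hle : ∀ x, ‖r x‖ ≤ ‖e x‖)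
    (hstar : ∀ x, ∃ y, e y = star (e x) ∧ r y = star (r x)) :
    ∃ Φ : A →⋆ₐ[ℂ] B, ∀ x, Φ (e x) = r x := by
  let T : A →L[ℂ] B := r.toLinearMap.extendOfNorm e.toLinearMap
  have hT : ∀ x, T (e x) = r x :=
    LinearMap.extendOfNorm_eq (f := r.toLinearMap) (e := e.toLinearMap) he
      ⟨1, fun x => by rw [one_mul]; exact hle x⟩
  have hone : T 1 = 1 := by rw [← map_one e, hT, map_one]
  have hmul : ∀ a b, T (a * b) = T a * T b := fun a b =>
    he.induction_on₂ (p := fun a b => T (a * b) = T a * T b)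
      (isClosed_eq (by fun_prop) (by fun_prop))
      (fun x y => by rw [← map_mul e, hT, hT, hT, map_mul r]) a b
  have hstar' : ∀ a, T (star a) = star (T a) := fun a =>
    he.induction_on (p := fun a => T (star a) = star (T a)) a
      (isClosed_eq (by fun_prop) (by fun_prop)) (fun x => by
        obtain ⟨y, hy, hy'⟩ := hstar x
        rw [← hy, hT, hT, hy'])
  let Ψ : A →ₐ[ℂ] B := AlgHom.ofLinearMap T.toLinearMap hone hmul
  exact ⟨{ Ψ with map_star' := hstar' }, hT⟩

end Range

/-! ### States restricting to the canonical trace -/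

section Trace

variable {G : Type u} [Group G] {E : Type w} [NormedAddCommGroup E]
  [InnerProductSpace ℂ E] [CompleteSpace E] (π : UnitaryRep G E)

namespace UnitaryRep

/-- The canonical map from the group algebra to `C*_π(G)`. -/
def algHomCstar : MonoidAlgebra ℂ G →ₐ[ℂ] π.cstar :=
  π.onGroupAlgebra.codRestrict π.cstar.toSubalgebra fun f =>
    StarSubalgebra.le_topologicalClosure π.groupStarAlgebra ⟨f, rfl⟩

theorem coe_algHomCstar (f : MonoidAlgebra ℂ G) :
    (π.algHomCstar f : E →L[ℂ] E) = π.onGroupAlgebra f := rfl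

theorem algHomCstar_single (g : G) (c : ℂ) :
    π.algHomCstar (MonoidAlgebra.single g c) = c • π.toCstar g :=
  Subtype.ext (π.onGroupAlgebra_single g c)

theorem denseRange_algHomCstar : DenseRange π.algHomCstar := by
  rintro ⟨a, ha⟩
  rw [closure_subtype]
  refine closure_mono ?_ ha
  rintro _ ⟨f, rfl⟩
  exact ⟨π.algHomCstar f, ⟨f, rfl⟩, rfl⟩

instance : IsClosed (π.cstar : Set (E →L[ℂ] E)) :=
  StarSubalgebra.isClosed_topologicalClosure _

theorem star_onGroupAlgebra_single (g : G) (c : ℂ) :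
    star (π.onGroupAlgebra (MonoidAlgebra.single g c)) =
      π.onGroupAlgebra (MonoidAlgebra.single g⁻¹ (star c)) := by
  rw [π.onGroupAlgebra_single, π.onGroupAlgebra_single, star_smul, map_inv,
    ← Unitary.star_eq_inv, Unitary.coe_star]

theorem exists_onGroupAlgebra_eq_star {F : Type*} [NormedAddCommGroup F]
    [InnerProductSpace ℂ F] [CompleteSpace F] (ρ : UnitaryRep G F) (f : MonoidAlgebra ℂ G) :
    ∃ k, π.onGroupAlgebra k = star (π.onGroupAlgebra f) ∧
      ρ.onGroupAlgebra k = star (ρ.onGroupAlgebra f) := by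
  induction f using MonoidAlgebra.induction_linear with
  | zero => exact ⟨0, by simp, by simp⟩
  | add f₁ f₂ h₁ h₂ =>
    obtain ⟨k₁, a₁, b₁⟩ := h₁
    obtain ⟨k₂, a₂, b₂⟩ := h₂
    exact ⟨k₁ + k₂, by rw [map_add, map_add, star_add, a₁, a₂],
      by rw [map_add, map_add, star_add, b₁, b₂]⟩
  | single g c =>
    exact ⟨MonoidAlgebra.single g⁻¹ (star c), (π.star_onGroupAlgebra_single g c).symm,
      (ρ.star_onGroupAlgebra_single g c).symm⟩

end UnitaryRep

/-- The functional `ψ` restricts to the canonical trace of the group algebra. -/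
def IsTraceOn (ψ : StrongDual ℂ (E →L[ℂ] E)) : Prop :=
  ∀ g : G, g ≠ 1 → ψ (π g : E →L[ℂ] E) = 0

/-- The Hilbert space `ℓ²(G)`. -/
abbrev EllTwo (G : Type u) : Type u := lp (fun _ : G => ℂ) 2

variable (G) in
/-- The unit vector `δ_1` of `ℓ²(G)`. -/
def deltaOne : EllTwo G :=
  letI := Classical.decEq G
  lp.single 2 1 1

variable (G) in
theorem deltaOne_ne_zero : deltaOne G ≠ 0 := by
  let := Classical.decEq G
  intro h
  have h' := congrArg (fun f : EllTwo G => f 1) h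
  simp [deltaOne] at h'

theorem regularRep_single_deltaOne [inst : DecidableEq G] (g : G) (c : ℂ) :
    (regularRep G).onGroupAlgebra (MonoidAlgebra.single g c) (deltaOne G) = lp.single 2 g c := by
  obtain rfl : inst = Classical.decEq G := Subsingleton.elim _ _
  let := Classical.decEq G
  rw [UnitaryRep.onGroupAlgebra_single]
  ext x
  change c * (deltaOne G) (g⁻¹ * x) = _
  rw [deltaOne, lp.single_apply, lp.single_apply, Pi.single_apply, Pi.single_apply]
  by_cases h : x = g
  · simp [h]
  · rw [if_neg h, if_neg (fun h' => h (inv_mul_eq_one.mp h').symm), mul_zero]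

/-- The vector `δ_1` is cyclic: the finite sums `∑ ξ(g) δ_g` converge to `ξ`. -/
theorem dense_regularRep_deltaOne :
    DenseRange fun k : MonoidAlgebra ℂ G => (regularRep G).onGroupAlgebra k (deltaOne G) := by
  classical
  intro ξ
  refine mem_closure_of_tendsto (lp.hasSum_single (by norm_num) ξ)
    (Filter.Eventually.of_forall fun s => ⟨∑ g ∈ s, MonoidAlgebra.single g (ξ g), ?_⟩)
  simp only [map_sum, sum_apply, regularRep_single_deltaOne]

variable {π}

/-- Identifies the GNS form of a trace state on the group algebra with that of `λ_G` and `δ_1`; by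
sesquilinearity only group elements need checking. -/
theorem IsTraceOn.inner_regularRep {ψ : StrongDual ℂ (E →L[ℂ] E)} (hψ : IsTraceOn π ψ)
    (h1 : IsState ψ) (k l : MonoidAlgebra ℂ G) :
    ψ (star (π.onGroupAlgebra k) * π.onGroupAlgebra l) =
      ⟪(regularRep G).onGroupAlgebra k (deltaOne G),
        (regularRep G).onGroupAlgebra l (deltaOne G)⟫_ℂ := by
  classical
  induction k using MonoidAlgebra.induction_linear with
  | zero => simp
  | add k₁ k₂ e₁ e₂ =>
    simp only [map_add, star_add, add_mul, e₁, e₂, add_apply, inner_add_left]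
  | single g c =>
    induction l using MonoidAlgebra.induction_linear with
    | zero => simp
    | add l₁ l₂ e₁ e₂ =>
      simp only [map_add, mul_add, e₁, e₂, add_apply, inner_add_right]
    | single h d =>
      rw [π.star_onGroupAlgebra_single, ← map_mul, MonoidAlgebra.single_mul_single,
        π.onGroupAlgebra_single, map_smul, regularRep_single_deltaOne, regularRep_single_deltaOne,
        lp.inner_single_left, lp.single_apply, Pi.single_apply]
      by_cases hgh : g = h
      · subst hgh
        simp [h1.map_one, mul_comm]
      · rw [hψ _ fun e => hgh (inv_mul_eq_one.mp e), if_neg hgh, smul_zero, inner_zero_right]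

theorem IsTraceOn.norm_regularRep_sq {ψ : StrongDual ℂ (E →L[ℂ] E)} (hψ : IsTraceOn π ψ)
    (h1 : IsState ψ) (k : MonoidAlgebra ℂ G) :
    ‖(regularRep G).onGroupAlgebra k (deltaOne G)‖ ^ 2 =
      (ψ (star (π.onGroupAlgebra k) * π.onGroupAlgebra k)).re := by
  rw [hψ.inner_regularRep h1, ← inner_self_eq_norm_sq (𝕜 := ℂ)]
  rfl

/-- On the dense set of vectors `λ(k)δ_1` this is the GNS bound `re_star_conj_le`. -/
theorem IsTraceOn.norm_regularRep_le {ψ : StrongDual ℂ (E →L[ℂ] E)} (hψ : IsTraceOn π ψ)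
    (h1 : IsState ψ) (f : MonoidAlgebra ℂ G) :
    ‖(regularRep G).onGroupAlgebra f‖ ≤ ‖π.onGroupAlgebra f‖ := by
  refine ContinuousLinearMap.opNorm_le_bound _ (norm_nonneg _) fun ξ => ?_
  refine (dense_regularRep_deltaOne (G := G)).induction_on (p := fun ξ =>
    ‖(regularRep G).onGroupAlgebra f ξ‖ ≤ ‖π.onGroupAlgebra f‖ * ‖ξ‖) ξ ?_ fun k => ?_
  · exact isClosed_le (by fun_prop) (by fun_prop)
  · rw [← sq_le_sq₀ (norm_nonneg _) (by positivity), mul_pow, ← mul_apply_eq_comp,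
      ← map_mul, hψ.norm_regularRep_sq h1, hψ.norm_regularRep_sq h1,
      map_mul π.onGroupAlgebra, star_mul]
    have h := h1.re_star_conj_le (π.onGroupAlgebra f) (π.onGroupAlgebra k)
    simpa only [mul_assoc] using h

/-- If every `π(f)` dominates `λ_G(f)` in norm, then `π(g) ↦ λ_G(g)` extends to `C*_π(G)`. -/
theorem exists_starAlgHom_regularRep
    (hle : ∀ f, ‖(regularRep G).onGroupAlgebra f‖ ≤ ‖π.onGroupAlgebra f‖) :
    ∃ Φ : π.cstar →⋆ₐ[ℂ] (regularRep G).cstar,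
      ∀ f, Φ (π.algHomCstar f) = (regularRep G).algHomCstar f := by
  refine exists_starAlgHom_of_norm_le π.algHomCstar (regularRep G).algHomCstar
    π.denseRange_algHomCstar hle fun f => ?_
  obtain ⟨k, h₁, h₂⟩ := π.exists_onGroupAlgebra_eq_star (regularRep G) f
  exact ⟨k, Subtype.ext h₁, Subtype.ext h₂⟩

/-- Elements annihilated with their multiples by a trace state lie in the kernel. -/
theorem IsTraceOn.map_eq_zero {ψ : StrongDual ℂ (E →L[ℂ] E)} (hψ : IsTraceOn π ψ)
    (h1 : IsState ψ) {Φ : π.cstar →⋆ₐ[ℂ] (regularRep G).cstar}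
    (hΦ : ∀ f, Φ (π.algHomCstar f) = (regularRep G).algHomCstar f) {I : TwoSidedIdeal π.cstar}
    (hI : ∀ a ∈ I, ψ (a : E →L[ℂ] E) = 0) {a : π.cstar} (ha : a ∈ I) : Φ a = 0 := by
  have hΦc : Continuous Φ := continuous_starAlgHom Φ
  have key : ∀ (b : π.cstar), ‖(Φ b : EllTwo G →L[ℂ] EllTwo G) (deltaOne G)‖ ^ 2 =
      (ψ ((star b * b : π.cstar) : E →L[ℂ] E)).re := fun b =>
    π.denseRange_algHomCstar.induction_on (p := fun b : π.cstar =>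
      ‖(Φ b : EllTwo G →L[ℂ] EllTwo G) (deltaOne G)‖ ^ 2 = (ψ ((star b * b : π.cstar) : E →L[ℂ] E)).re) b
      (isClosed_eq (by fun_prop) (by fun_prop)) (fun f => by
        rw [hΦ]; exact hψ.norm_regularRep_sq h1 f)
  apply Subtype.ext
  refine ContinuousLinearMap.ext fun ξ => ?_
  refine (dense_regularRep_deltaOne (G := G)).induction_on (p := fun ξ =>
    (Φ a : EllTwo G →L[ℂ] EllTwo G) ξ = 0) ξ ?_ fun k => ?_
  · exact isClosed_eq (by fun_prop) (by fun_prop)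
  -- With `b = a π(k)`, the element `b*b` lies in `I`, so `Φ(a)` kills `λ(k)δ_1`.
  · have h := key (a * π.algHomCstar k)
    rw [hI _ (I.mul_mem_left _ _ (I.mul_mem_right _ _ ha)), map_mul, hΦ] at h
    simpa [UnitaryRep.coe_algHomCstar] using h

end Trace

/-! ### Equivariant maps from continuous functions on a boundary -/

section Boundary

open Filter Topology
open scoped Pointwise

variable {G : Type u} [Group G] {X : Type v} [TopologicalSpace X]
  [MulAction G X] [ContinuousConstSMul G X]

/-- The translate `x ↦ f(g⁻¹ x)` of a continuous function. -/
def translateFun (g : G) (f : C(X, ℝ)) : C(X, ℝ) :=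
  f.comp ⟨fun x => g⁻¹ • x, continuous_const_smul g⁻¹⟩

theorem translateFun_apply (g : G) (f : C(X, ℝ)) (x : X) : translateFun g f x = f (g⁻¹ • x) := rfl

variable {E : Type w} [NormedAddCommGroup E] [InnerProductSpace ℂ E] [CompleteSpace E]

/-- Unital equivariant maps from `C(X, ℝ)` to self-adjoint operators, such that for `0 ≤ f ≤ 1` the
operators `θ(f)` and `θ(f) - θ(f)²` are positive contractions. -/
structure IsCovariant (π : UnitaryRep G E) (θ : C(X, ℝ) →ₗ[ℝ] (E →L[ℂ] E)) : Prop where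
  map_one : θ 1 = 1
  star_eq : ∀ f, star (θ f) = θ f
  norm_one_sub_le : ∀ f : C(X, ℝ), (∀ x, 0 ≤ f x) → (∀ x, f x ≤ 1) → ‖1 - θ f‖ ≤ 1
  norm_one_sub_sub_le : ∀ f : C(X, ℝ), (∀ x, 0 ≤ f x) → (∀ x, f x ≤ 1) →
    ‖1 - (θ f - θ f * θ f)‖ ≤ 1
  covariant : ∀ g f, (π g : E →L[ℂ] E) * θ f = θ (translateFun g f) * (π g : E →L[ℂ] E)

namespace IsCovariant

variable {π : UnitaryRep G E} {θ : C(X, ℝ) →ₗ[ℝ] (E →L[ℂ] E)}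

/-- A substitute for multiplicativity of `θ`: if `φ(θ(f))` vanishes then so does `φ(θ(f)²)`, as
Cauchy-Schwarz requires. -/
theorem re_mul_self_le (hθ : IsCovariant π θ) {φ : StrongDual ℂ (E →L[ℂ] E)} (hφ : IsState φ)
    {f : C(X, ℝ)} (h0 : ∀ x, 0 ≤ f x) (h1 : ∀ x, f x ≤ 1) :
    (φ (θ f * θ f)).re ≤ (φ (θ f)).re := by
  have h := hφ.re_nonneg_of_norm_one_sub_le (hθ.norm_one_sub_sub_le f h0 h1)
  rw [map_sub, Complex.sub_re] at h
  linarith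

/-- A state which restricts to the evaluation at a point with trivial stabilizer on `C(X, ℝ)`
restricts to the canonical trace on the group. -/
theorem isTraceOn [CompactSpace X] [T2Space X] (hθ : IsCovariant π θ)
    {ψ : StrongDual ℂ (E →L[ℂ] E)} (hψ : IsState ψ) {x : X} (hx : ∀ g : G, g ≠ 1 → g • x ≠ x)
    (heval : ∀ f, (ψ (θ f)).re = f x) : IsTraceOn π ψ := by
  intro g hg
  have hne : g⁻¹ • x ≠ x := hx _ (inv_ne_one.mpr hg)
  -- With `gf` the translate of `f`, `f(x) = 0` gives `ψ(π(g)θ(f)) = 0`, and `(gf)(x) = f(g⁻¹x) = 1`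
  -- gives `ψ(π(g)) = ψ(θ(gf)π(g))`; covariance identifies `θ(gf)π(g)` with `π(g)θ(f)`.
  obtain ⟨f, hf0, hf1, hf⟩ := exists_continuous_zero_one_of_isClosed (X := X)
    (isClosed_singleton (x := x)) (isClosed_singleton (x := g⁻¹ • x))
    (Set.disjoint_singleton.mpr hne.symm)
  have hfx : f x = 0 := hf0 rfl
  have hfg : f (g⁻¹ • x) = 1 := hf1 rfl
  have hright : ψ ((π g : E →L[ℂ] E) * θ f) = 0 := by
    refine hψ.map_mul_eq_zero_right ?_ _
    rw [hθ.star_eq]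
    refine (hθ.re_mul_self_le hψ (fun y => (hf y).1) fun y => (hf y).2).trans ?_
    rw [heval, hfx]
  have hleft : ψ (θ (1 - translateFun g f) * (π g : E →L[ℂ] E)) = 0 := by
    refine hψ.map_mul_eq_zero_left ?_ _
    rw [hθ.star_eq]
    refine (hθ.re_mul_self_le hψ (fun y => ?_) fun y => ?_).trans ?_
    · simpa [translateFun_apply] using (hf (g⁻¹ • y)).2
    · simpa [translateFun_apply] using (hf (g⁻¹ • y)).1
    · rw [heval]; simp [translateFun_apply, hfg]
  rw [map_sub, hθ.map_one, sub_mul, one_mul, ← hθ.covariant, map_sub, hright, sub_zero] at hleft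
  exact hleft

variable [CompactSpace X] [T2Space X] [MeasurableSpace X] [BorelSpace X]

/-- The state `φ ∘ θ` of `C(X, ℝ)` is a regular probability measure. -/
theorem exists_measure (hθ : IsCovariant π θ) {φ : StrongDual ℂ (E →L[ℂ] E)} (hφ : IsState φ) :
    ∃ μ : ProbabilityMeasure X, (μ : Measure X).Regular ∧
      ∀ f : C(X, ℝ), ∫ x, f x ∂(μ : Measure X) = (φ (θ f)).re := by
  have hpos : ∀ f : C(X, ℝ), (∀ x, 0 ≤ f x) → 0 ≤ (φ (θ f)).re := by
    intro f hf
    -- `IsCovariant` only controls functions with values in `[0, 1]`, so `f` is rescaled; the `+ 1`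
    -- covers `f = 0`.
    have hc : 0 < ‖f‖ + 1 := by positivity
    have h := hφ.re_nonneg_of_norm_one_sub_le (hθ.norm_one_sub_le ((‖f‖ + 1)⁻¹ • f)
      (fun x => mul_nonneg (by positivity) (hf x)) fun x => by
        change (‖f‖ + 1)⁻¹ * f x ≤ 1
        rw [inv_mul_le_one₀ hc]
        exact (le_abs_self _).trans ((f.norm_coe_le_norm x).trans (by linarith)))
    rw [map_smul, ← Complex.coe_smul, map_smul, smul_eq_mul, Complex.re_ofReal_mul] at h
    exact nonneg_of_mul_nonneg_right h (by positivity)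
  let Λ : CompactlySupportedContinuousMap X ℝ →ₚ[ℝ] ℝ := PositiveLinearMap.mk₀
    { toFun := fun f => (φ (θ f.toContinuousMap)).re
      map_add' := fun f g => by
        change (φ (θ (f.toContinuousMap + g.toContinuousMap))).re = _
        rw [map_add, map_add, Complex.add_re]
      map_smul' := fun c f => by
        change (φ (θ (c • f.toContinuousMap))).re = c * _
        rw [map_smul, ← Complex.coe_smul, map_smul, smul_eq_mul, Complex.re_ofReal_mul] }
    fun f hf => hpos f.toContinuousMap hf
  have hint : ∀ f : C(X, ℝ), ∫ x, f x ∂(RealRMK.rieszMeasure Λ) = (φ (θ f)).re := fun f =>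
    RealRMK.integral_rieszMeasure Λ (CompactlySupportedContinuousMap.continuousMapEquiv f)
  have hprob : IsProbabilityMeasure (RealRMK.rieszMeasure Λ) := by
    have h := hint 1
    rw [hθ.map_one, hφ.map_one] at h
    simp only [ContinuousMap.one_apply, integral_const, smul_eq_mul, mul_one,
      Complex.one_re] at h
    refine ⟨?_⟩
    rw [← ENNReal.toReal_eq_one_iff]
    exact h
  exact ⟨⟨RealRMK.rieszMeasure Λ, hprob⟩, RealRMK.regular_rieszMeasure Λ, hint⟩

end IsCovariant

/-- The functional `T ↦ φ(π(g)⁻¹ T π(g))`. -/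
def conjFunctional (π : UnitaryRep G E) (φ : StrongDual ℂ (E →L[ℂ] E)) (g : G) :
    StrongDual ℂ (E →L[ℂ] E) :=
  φ.comp (ContinuousLinearMap.mulLeftRight ℂ (E →L[ℂ] E) (π g⁻¹ : E →L[ℂ] E) (π g : E →L[ℂ] E))

theorem conjFunctional_apply (π : UnitaryRep G E) (φ : StrongDual ℂ (E →L[ℂ] E)) (g : G)
    (T : E →L[ℂ] E) :
    conjFunctional π φ g T = φ ((π g⁻¹ : E →L[ℂ] E) * T * (π g : E →L[ℂ] E)) := rfl

theorem UnitaryRep.inv_mul_coe (π : UnitaryRep G E) (g : G) :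
    (π g⁻¹ : E →L[ℂ] E) * (π g : E →L[ℂ] E) = 1 := by
  rw [← Submonoid.coe_mul, ← map_mul, inv_mul_cancel, map_one, OneMemClass.coe_one]

theorem IsState.conjFunctional {φ : StrongDual ℂ (E →L[ℂ] E)} (hφ : IsState φ)
    (π : UnitaryRep G E) (g : G) : IsState (conjFunctional π φ g) where
  norm_le := by
    refine ContinuousLinearMap.opNorm_le_bound _ zero_le_one fun T => ?_
    rw [conjFunctional_apply, one_mul]
    refine (hφ.norm_apply_le _).trans_eq ?_
    rw [CStarRing.norm_mul_coe_unitary, CStarRing.norm_coe_unitary_mul]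
  map_one := by
    rw [conjFunctional_apply, mul_one, π.inv_mul_coe, hφ.map_one]

/-- A two-sided ideal is stable under conjugation by the unitaries `π(g)`, which belong to the
algebra. -/
theorem conjFunctional_eq_zero {π : UnitaryRep G E} {φ : StrongDual ℂ (E →L[ℂ] E)}
    {I : TwoSidedIdeal π.cstar} (hI : ∀ a ∈ I, φ (a : E →L[ℂ] E) = 0) (g : G) {a : π.cstar}
    (ha : a ∈ I) : conjFunctional π φ g (a : E →L[ℂ] E) = 0 :=
  hI (π.toCstar g⁻¹ * a * π.toCstar g) (I.mul_mem_right _ _ (I.mul_mem_left _ _ ha))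

/-- If `φ ∘ θ` is integration against `μ`, the right-hand side is integration of `f` against `g_*μ`.
-/
theorem IsCovariant.conjFunctional_apply {π : UnitaryRep G E}
    {θ : C(X, ℝ) →ₗ[ℝ] (E →L[ℂ] E)} (hθ : IsCovariant π θ) (φ : StrongDual ℂ (E →L[ℂ] E))
    (g : G) (f : C(X, ℝ)) :
    conjFunctional π φ g (θ f) = φ (θ (translateFun g⁻¹ f)) := by
  rw [IndRep.conjFunctional_apply, hθ.covariant, mul_assoc, π.inv_mul_coe, mul_one]

theorem integral_pushforward [MeasurableSpace X] [BorelSpace X] (g : G) (μ : ProbabilityMeasure X) (f : C(X, ℝ)) :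
    ∫ x, f x ∂(pushforward g μ : Measure X) = ∫ x, f (g • x) ∂(μ : Measure X) :=
  integral_map (continuous_const_smul g).measurable.aemeasurable
    f.continuous.measurable.aestronglyMeasurable

/-- In a boundary action every point measure lies in the closure of every orbit. -/
theorem IsBoundaryAction.diracProba_mem_closure [MeasurableSpace X] [BorelSpace X]
    (hX : IsBoundaryAction G X)
    {μ : ProbabilityMeasure X} (hμ : (μ : Measure X).Regular) (x : X) :
    diracProba x ∈ closure (Set.range fun g : G => pushforward g μ) := by
  set C := closure (Set.range fun g : G => pushforward g μ) with hC
  have := hX.minimal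
  -- The points whose Dirac mass lies in `C` form a closed invariant set, nonempty by strong
  -- proximality, hence all of `X` by minimality.
  have hclosed : IsClosed {y : X | diracProba y ∈ C} :=
    isClosed_closure.preimage continuous_diracProba
  have hinv : ∀ g : G, g • {y : X | diracProba y ∈ C} ⊆ {y : X | diracProba y ∈ C} := by
    rintro g _ ⟨y, hy, rfl⟩
    have hcont : Continuous fun ν : ProbabilityMeasure X => pushforward g ν :=
      ProbabilityMeasure.continuous_map (continuous_const_smul g)
    have hmaps : Set.MapsTo (fun ν : ProbabilityMeasure X => pushforward g ν) C C := by
      refine Set.MapsTo.closure ?_ hcont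
      rintro _ ⟨k, rfl⟩
      refine ⟨g * k, ?_⟩
      apply Subtype.ext
      change (μ : Measure X).map _ = ((μ : Measure X).map _).map _
      rw [Measure.map_map (continuous_const_smul g).measurable
        (continuous_const_smul k).measurable]
      congr 1
      ext z
      exact mul_smul g k z
    have h := hmaps hy
    have e : pushforward g (diracProba y) = diracProba (g • y) := by
      apply Subtype.ext
      exact Measure.map_dirac' (continuous_const_smul g).measurable y
    change diracProba (g • y) ∈ C
    rw [← e]
    exact h
  rcases eq_empty_or_univ_of_smul_invariant_closed G hclosed hinv with h | h
  · obtain ⟨y, hy⟩ := hX.stronglyProximal μ hμ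
    exact absurd (show y ∈ {y : X | diracProba y ∈ C} from hy) (h ▸ Set.notMem_empty y)
  · exact h.ge (Set.mem_univ x)

section

variable [CompactSpace X] [T2Space X]

/-- In a topologically free action of a countable group some point has a trivial stabilizer. -/
theorem exists_forall_smul_ne [Countable G] [Nonempty X] (hfree : IsTopologicallyFree G X) :
    ∃ x : X, ∀ g : G, g ≠ 1 → g • x ≠ x := by
  -- Baire category: countably many open sets, dense by topological freeness.
  have hd : Dense (⋂ g : {g : G // g ≠ 1}, (MulAction.fixedBy X g.1)ᶜ) := by
    refine dense_iInter_of_isOpen (fun g => ?_) fun g => ?_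
    · exact (isClosed_eq (continuous_const_smul g.1) continuous_id).isOpen_compl
    · rw [← interior_eq_empty_iff_dense_compl]
      exact hfree g.1 g.2
  obtain ⟨x, hx⟩ := hd.nonempty
  exact ⟨x, fun g hg => Set.mem_iInter.mp hx ⟨g, hg⟩⟩

variable [MeasurableSpace X] [BorelSpace X]

/-- A state annihilating an ideal can be moved to one that is a point evaluation on `C(X, ℝ)`. -/
theorem IsCovariant.exists_isState_eval (hX : IsBoundaryAction G X) {π : UnitaryRep G E}
    {θ : C(X, ℝ) →ₗ[ℝ] (E →L[ℂ] E)} (hθ : IsCovariant π θ) {I : TwoSidedIdeal π.cstar}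
    {φ : StrongDual ℂ (E →L[ℂ] E)} (hφ : IsState φ) (hI : ∀ a ∈ I, φ (a : E →L[ℂ] E) = 0)
    (x : X) :
    ∃ ψ : StrongDual ℂ (E →L[ℂ] E), IsState ψ ∧ (∀ a ∈ I, ψ (a : E →L[ℂ] E) = 0) ∧
      ∀ f, (ψ (θ f)).re = f x := by
  obtain ⟨μ, hμ, hint⟩ := hθ.exists_measure hφ
  have hne : (comap (fun g : G => pushforward g μ) (𝓝 (diracProba x))).NeBot :=
    comap_neBot fun t ht => by
      obtain ⟨_, h, g, rfl⟩ := mem_closure_iff_nhds.mp (hX.diracProba_mem_closure hμ x) t ht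
      exact ⟨g, h⟩
  -- An ultrafilter on `G` along which `g_*μ` tends to the point mass at `x`; by Banach-Alaoglu the
  -- conjugates of `φ` converge weak* along it.
  let U : Ultrafilter G := Ultrafilter.of (comap (fun g : G => pushforward g μ) (𝓝 (diracProba x)))
  have hU : Tendsto (fun g : G => pushforward g μ) U (𝓝 (diracProba x)) :=
    tendsto_comap.mono_left (Ultrafilter.of_le _)
  let F : G → WeakDual ℂ (E →L[ℂ] E) := fun g => StrongDual.toWeakDual (conjFunctional π φ g)
  obtain ⟨ψ, hψ, hlim⟩ := (WeakDual.isCompact_closedBall (𝕜 := ℂ)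
    (0 : StrongDual ℂ (E →L[ℂ] E)) 1).ultrafilter_le_nhds' (U.map F) (by
      refine Ultrafilter.mem_map.mpr (Filter.univ_mem' fun g => ?_)
      change conjFunctional π φ g ∈ Metric.closedBall 0 1
      rw [mem_closedBall_zero_iff]
      exact (hφ.conjFunctional π g).norm_le)
  have hT : ∀ T : E →L[ℂ] E, Tendsto (fun g => conjFunctional π φ g T) U (𝓝 (ψ T)) := fun T =>
    ((WeakDual.eval_continuous T).tendsto ψ).comp hlim
  refine ⟨WeakDual.toStrongDual ψ, ⟨mem_closedBall_zero_iff.mp hψ, ?_⟩, fun a ha => ?_,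
    fun f => ?_⟩
  -- The value at `1`, and below the values on `I`, are the same for every conjugate and so survive
  -- in the limit.
  · exact tendsto_nhds_unique (hT 1)
      (tendsto_const_nhds.congr fun g => ((hφ.conjFunctional π g).map_one).symm)
  · exact tendsto_nhds_unique (hT a)
      (tendsto_const_nhds.congr fun g => (conjFunctional_eq_zero hI g ha).symm)
  · have h1 := (Complex.continuous_re.tendsto _).comp (hT (θ f))
    have h2 := ProbabilityMeasure.tendsto_iff_forall_integral_tendsto.mp hU
      (BoundedContinuousFunction.mkOfCompact f)
    refine tendsto_nhds_unique h1 ?_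
    have h3 : ∫ y, BoundedContinuousFunction.mkOfCompact f y ∂(diracProba x : Measure X) = f x :=
      integral_dirac f x
    rw [h3] at h2
    refine h2.congr fun g => ?_
    change _ = (conjFunctional π φ g (θ f)).re
    rw [hθ.conjFunctional_apply, ← hint]
    refine (integral_pushforward g μ f).trans ?_
    simp only [translateFun_apply, inv_inv]

end

end Boundary

/-! ### Multiplication operators on the space of an induced representation -/

section Multiplication

variable {G : Type u} [Group G] {H : Subgroup G} {K : Type w} [NormedAddCommGroup K]
  [InnerProductSpace ℂ K] [CompleteSpace K] (σ : UnitaryRep H K)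

/-- Bounded real functions on `G` that are constant on the cosets `xH`. -/
structure IsMultiplier (H : Subgroup G) (m : G → ℝ) (C : ℝ) : Prop where
  map_mul_right : ∀ (x : G) (h : H), m (x * h) = m x
  abs_le : ∀ x, |m x| ≤ C

variable {m : G → ℝ} {C : ℝ}

theorem IsMultiplier.nonneg (hm : IsMultiplier H m C) : 0 ≤ C :=
  (abs_nonneg _).trans (hm.abs_le 1)

theorem IsMultiplier.norm_smul_sq_le (hm : IsMultiplier H m C) (F : IndSpace σ) (x : G) :
    ‖(m x : ℂ) • F x‖ ^ 2 ≤ C ^ 2 * ‖F x‖ ^ 2 := by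
  rw [norm_smul, Complex.norm_real, mul_pow]
  exact mul_le_mul_of_nonneg_right (pow_le_pow_left₀ (abs_nonneg _) (hm.abs_le x) 2)
    (sq_nonneg _)

theorem IndSpace.summable_norm_sq (F : IndSpace σ) : Summable fun c : G ⧸ H => ‖F c.out‖ ^ 2 :=
  F.2.2

/-- Multiplication by a function constant on cosets, as a linear map. -/
def mulLinear (hm : IsMultiplier H m C) : IndSpace σ →ₗ[ℂ] IndSpace σ where
  toFun F := ⟨fun x => (m x : ℂ) • F x, fun x h => by
      change (m (x * h) : ℂ) • F (x * h) = (σ h⁻¹ : K →L[ℂ] K) ((m x : ℂ) • F x)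
      rw [hm.map_mul_right, F.map_mul_right, map_smul],
    Summable.of_nonneg_of_le (fun _ => sq_nonneg _) (fun c => hm.norm_smul_sq_le σ F c.out)
      (F.summable_norm_sq.mul_left (C ^ 2))⟩
  map_add' F₁ F₂ := IndSpace.ext fun x => smul_add (m x : ℂ) (F₁ x) (F₂ x)
  map_smul' a F := IndSpace.ext fun x => smul_comm (m x : ℂ) a (F x)

theorem norm_mulLinear_le (hm : IsMultiplier H m C) (F : IndSpace σ) :
    ‖mulLinear σ hm F‖ ≤ C * ‖F‖ := by
  rw [← sq_le_sq₀ (norm_nonneg _) (mul_nonneg hm.nonneg (norm_nonneg _)), mul_pow,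
    IndSpace.norm_sq_eq, IndSpace.norm_sq_eq, ← tsum_mul_left]
  exact (mulLinear σ hm F).summable_norm_sq.tsum_le_tsum
    (fun c => hm.norm_smul_sq_le σ F c.out) (F.summable_norm_sq.mul_left (C ^ 2))

/-- Multiplication by a bounded function constant on cosets. -/
def mulOp (hm : IsMultiplier H m C) : IndSpace σ →L[ℂ] IndSpace σ :=
  (mulLinear σ hm).mkContinuous C (norm_mulLinear_le σ hm)

theorem mulOp_apply (hm : IsMultiplier H m C) (F : IndSpace σ) (x : G) :
    mulOp σ hm F x = (m x : ℂ) • F x := rfl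

theorem norm_mulOp_le (hm : IsMultiplier H m C) : ‖mulOp σ hm‖ ≤ C :=
  LinearMap.mkContinuous_norm_le _ hm.nonneg _

theorem star_mulOp (hm : IsMultiplier H m C) : star (mulOp σ hm) = mulOp σ hm := by
  refine ((ContinuousLinearMap.eq_adjoint_iff _ _).mpr fun F₁ F₂ => ?_).symm
  rw [IndSpace.inner_def, IndSpace.inner_def]
  refine tsum_congr fun c => ?_
  rw [mulOp_apply, mulOp_apply, inner_smul_left, inner_smul_right, Complex.conj_ofReal]

variable {σ} in
theorem opExt {S T : IndSpace σ →L[ℂ] IndSpace σ} (h : ∀ F x, S F x = T F x) : S = T :=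
  ContinuousLinearMap.ext fun F => IndSpace.ext (h F)

end Multiplication

/-! ### The Poisson transform of an invariant measure -/

section Poisson

variable {G : Type u} [Group G] {H : Subgroup G} {K : Type w} [NormedAddCommGroup K]
  [InnerProductSpace ℂ K] [CompleteSpace K] (σ : UnitaryRep H K)
  {X : Type v} [TopologicalSpace X] [MeasurableSpace X] [MulAction G X]
  {ν : ProbabilityMeasure X}

/-- The function `x ↦ ∫ f(xy) dν(y)` on `G`. -/
def poisson (ν : ProbabilityMeasure X) (f : C(X, ℝ)) (x : G) : ℝ :=
  ∫ y, f (x • y) ∂(ν : Measure X)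

theorem poisson_smul (c : ℝ) (f : C(X, ℝ)) (x : G) :
    poisson ν (c • f) x = c * poisson ν f x :=
  integral_const_mul c _

theorem poisson_one (x : G) : poisson ν (1 : C(X, ℝ)) x = 1 := by
  simp [poisson]

theorem poisson_nonneg {f : C(X, ℝ)} (hf : ∀ y, 0 ≤ f y) (x : G) : 0 ≤ poisson ν f x :=
  integral_nonneg fun _ => hf _

theorem poisson_translateFun [ContinuousConstSMul G X] (f : C(X, ℝ)) (g x : G) :
    poisson ν (translateFun g f) x = poisson ν f (g⁻¹ * x) := by
  simp only [poisson, translateFun_apply, mul_smul]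

variable [CompactSpace X] [BorelSpace X] [ContinuousConstSMul G X]

theorem integrable_translate (ν : ProbabilityMeasure X) (f : C(X, ℝ)) (x : G) :
    Integrable (fun y => f (x • y)) (ν : Measure X) :=
  (BoundedContinuousFunction.mkOfCompact
    (f.comp ⟨fun y => x • y, continuous_const_smul x⟩)).integrable _

theorem poisson_add (f₁ f₂ : C(X, ℝ)) (x : G) :
    poisson ν (f₁ + f₂) x = poisson ν f₁ x + poisson ν f₂ x :=
  integral_add (integrable_translate ν f₁ x) (integrable_translate ν f₂ x)

theorem poisson_le_one {f : C(X, ℝ)} (hf : ∀ y, f y ≤ 1) (x : G) : poisson ν f x ≤ 1 := by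
  rw [← poisson_one (ν := ν) x]
  exact integral_mono (integrable_translate ν f x) (integrable_translate ν 1 x) fun _ => hf _

/-- Here the invariance of `ν` enters: `∫ f(xhy) dν(y) = ∫ f(xy) dν(y)`, so the transform descends
to `G ⧸ H`. -/
theorem isMultiplier_poisson (hν : ∀ h ∈ H, pushforward h ν = ν) (f : C(X, ℝ)) :
    IsMultiplier H (poisson ν f) ‖f‖ where
  map_mul_right x h := by
    have e := integral_pushforward (h : G) ν (f.comp ⟨fun y => x • y, continuous_const_smul x⟩)
    rw [hν h h.2] at e
    simp only [poisson, mul_smul]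
    exact e.symm
  abs_le x := by
    have h := norm_integral_le_of_norm_le_const (μ := (ν : Measure X))
      (f := fun y => f (x • y)) (Filter.Eventually.of_forall fun y => f.norm_coe_le_norm (x • y))
    simpa [poisson] using h

/-- Multiplication by the Poisson transform. -/
def poissonOp (hν : ∀ h ∈ H, pushforward h ν = ν) :
    C(X, ℝ) →ₗ[ℝ] (IndSpace σ →L[ℂ] IndSpace σ) where
  toFun f := mulOp σ (isMultiplier_poisson hν f)
  map_add' f₁ f₂ := opExt fun F x => by
    change ((poisson ν (f₁ + f₂) x : ℝ) : ℂ) • F x =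
      (poisson ν f₁ x : ℂ) • F x + (poisson ν f₂ x : ℂ) • F x
    rw [poisson_add, Complex.ofReal_add, add_smul]
  map_smul' c f := opExt fun F x => by
    change ((poisson ν (c • f) x : ℝ) : ℂ) • F x = (c : ℂ) • (poisson ν f x : ℂ) • F x
    rw [poisson_smul, Complex.ofReal_mul, mul_smul]

theorem poissonOp_apply (hν : ∀ h ∈ H, pushforward h ν = ν) (f : C(X, ℝ)) (F : IndSpace σ)
    (x : G) : poissonOp σ hν f F x = (poisson ν f x : ℂ) • F x := rfl

/-- The operators `θ(f)` are multiplications, so every condition is checked pointwise on `G`. For `0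
≤ f ≤ 1` the transform takes values `t` in `[0, 1]`, and then `1 - t` and `1 - (t - t²)` lie in `[0,
1]` as well. -/
theorem isCovariant_poissonOp (hν : ∀ h ∈ H, pushforward h ν = ν) :
    IsCovariant (inducedRep σ) (poissonOp (X := X) σ hν) where
  map_one := opExt fun F x => by
    rw [poissonOp_apply, poisson_one, Complex.ofReal_one, one_smul]
    rfl
  star_eq f := star_mulOp σ _
  norm_one_sub_le f h0 h1 := by
    have hm : IsMultiplier H (fun x => 1 - poisson ν f x) 1 :=
      ⟨fun x h => by rw [(isMultiplier_poisson hν f).map_mul_right], fun x => by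
        rw [abs_le]
        constructor <;> linarith [poisson_nonneg (ν := ν) h0 x, poisson_le_one (ν := ν) h1 x]⟩
    have e : 1 - poissonOp σ hν f = mulOp σ hm := opExt fun F x => by
      change F x - (poisson ν f x : ℂ) • F x = ((1 - poisson ν f x : ℝ) : ℂ) • F x
      rw [Complex.ofReal_sub, Complex.ofReal_one, sub_smul, one_smul]
    rw [e]
    exact norm_mulOp_le σ hm
  norm_one_sub_sub_le f h0 h1 := by
    have hm : IsMultiplier H
        (fun x => 1 - (poisson ν f x - poisson ν f x * poisson ν f x)) 1 :=
      ⟨fun x h => by rw [(isMultiplier_poisson hν f).map_mul_right], fun x => by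
        have a := poisson_nonneg (ν := ν) h0 x
        have b := poisson_le_one (ν := ν) h1 x
        rw [abs_le]
        constructor <;> nlinarith⟩
    have e : 1 - (poissonOp σ hν f - poissonOp σ hν f * poissonOp σ hν f) = mulOp σ hm :=
      opExt fun F x => by
        change F x - ((poisson ν f x : ℂ) • F x - (poisson ν f x : ℂ) • (poisson ν f x : ℂ) • F x)
          = ((1 - (poisson ν f x - poisson ν f x * poisson ν f x) : ℝ) : ℂ) • F x
        push_cast
        simp only [sub_smul, one_smul, mul_smul]
    rw [e]
    exact norm_mulOp_le σ hm
  covariant g f := opExt fun F x => by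
    change (poisson ν f (g⁻¹ * x) : ℂ) • F (g⁻¹ * x) =
      (poisson ν (translateFun g f) x : ℂ) • F (g⁻¹ * x)
    rw [poisson_translateFun]

end Poisson

/-! ### The homomorphism onto the reduced C*-algebra and its kernel -/

section Kernel

variable {G : Type u} [Group G] {E : Type w} [NormedAddCommGroup E]
  [InnerProductSpace ℂ E] [CompleteSpace E] {π : UnitaryRep G E}

variable (π) in
theorem bot_ne_top_cstar [Nontrivial E] : (⊥ : TwoSidedIdeal π.cstar) ≠ ⊤ := by
  intro h
  have h1 : (1 : π.cstar) ∈ (⊥ : TwoSidedIdeal π.cstar) := h ▸ trivial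
  rw [TwoSidedIdeal.mem_bot] at h1
  exact one_ne_zero (congrArg Subtype.val h1)

variable {Φ : π.cstar →⋆ₐ[ℂ] (regularRep G).cstar}

theorem map_toCstar (hΦ : ∀ f, Φ (π.algHomCstar f) = (regularRep G).algHomCstar f) (g : G) :
    Φ (π.toCstar g) = (regularRep G).toCstar g := by
  have h := hΦ (MonoidAlgebra.single g 1)
  rwa [UnitaryRep.algHomCstar_single, UnitaryRep.algHomCstar_single, one_smul, one_smul] at h

theorem surjective_regularRep
    (hΦ : ∀ f, Φ (π.algHomCstar f) = (regularRep G).algHomCstar f) : Function.Surjective Φ := by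
  refine surjective_of_denseRange Φ fun b =>
    closure_mono ?_ ((regularRep G).denseRange_algHomCstar b)
  rintro _ ⟨f, rfl⟩
  exact ⟨_, hΦ f⟩

theorem isClosed_ker (Φ : π.cstar →⋆ₐ[ℂ] (regularRep G).cstar) :
    IsClosed (TwoSidedIdeal.ker Φ : Set π.cstar) := by
  have e : (TwoSidedIdeal.ker Φ : Set π.cstar) = Φ ⁻¹' {0} := by
    ext a
    exact TwoSidedIdeal.mem_ker Φ
  rw [e]
  exact isClosed_singleton.preimage (continuous_starAlgHom Φ)

theorem ker_ne_top (Φ : π.cstar →⋆ₐ[ℂ] (regularRep G).cstar) : TwoSidedIdeal.ker Φ ≠ ⊤ := by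
  intro h
  have h1 : (1 : π.cstar) ∈ TwoSidedIdeal.ker Φ := h ▸ trivial
  rw [TwoSidedIdeal.mem_ker, map_one] at h1
  have h2 : (1 : EllTwo G →L[ℂ] EllTwo G) = 0 := congrArg Subtype.val h1
  exact deltaOne_ne_zero G (congrArg (fun T => T (deltaOne G)) h2)

/-- If every proper ideal is annihilated by a trace state, then the kernel of the map onto the
reduced C*-algebra is the largest proper closed ideal. -/
theorem isGreatest_ker (hΦ : ∀ f, Φ (π.algHomCstar f) = (regularRep G).algHomCstar f)
    (htr : ∀ I : TwoSidedIdeal π.cstar, I ≠ ⊤ →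
      ∃ ψ : StrongDual ℂ (E →L[ℂ] E), IsState ψ ∧ IsTraceOn π ψ ∧
        ∀ a ∈ I, ψ (a : E →L[ℂ] E) = 0) :
    IsGreatest {I : TwoSidedIdeal π.cstar | IsClosed (I : Set π.cstar) ∧ I ≠ ⊤}
      (TwoSidedIdeal.ker Φ) := by
  refine ⟨⟨isClosed_ker Φ, ker_ne_top Φ⟩, fun I hI a ha => ?_⟩
  obtain ⟨ψ, hψ, hψtr, hψI⟩ := htr I hI.2
  exact (TwoSidedIdeal.mem_ker Φ).mpr (hψtr.map_eq_zero hψ hΦ hψI ha)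

end Kernel

theorem IndSpace.nontrivial {G : Type u} [Group G] {H : Subgroup G} {K : Type w}
    [NormedAddCommGroup K] [InnerProductSpace ℂ K] [CompleteSpace K] [Nontrivial K]
    (σ : UnitaryRep H K) : Nontrivial (IndSpace σ) := by
  classical
  obtain ⟨v, hv⟩ := exists_ne (0 : K)
  have : Nontrivial (lp (fun _ : G ⧸ H => K) 2) := by
    refine ⟨lp.single 2 ((1 : G) : G ⧸ H) v, 0, fun h => hv ?_⟩
    have h' := congrArg (fun f : lp (fun _ : G ⧸ H => K) 2 => f ((1 : G) : G ⧸ H)) h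
    simpa using h'
  exact toLp_surjective.nontrivial

/-- Every proper ideal of `C*_π(G)`, `π` induced from a weakly parabolic subgroup, is annihilated
by a state restricting to the canonical trace. -/
theorem IsWeaklyParabolic.exists_trace {G : Type u} [Group G] [Countable G] {H : Subgroup G}
    (hH : IsWeaklyParabolic.{u, v} H) {K : Type w} [NormedAddCommGroup K]
    [InnerProductSpace ℂ K] [CompleteSpace K] (σ : UnitaryRep H K)
    {I : TwoSidedIdeal (inducedRep σ).cstar} (hI : I ≠ ⊤) :
    ∃ ψ : StrongDual ℂ (IndSpace σ →L[ℂ] IndSpace σ), IsState ψ ∧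
      IsTraceOn (inducedRep σ) ψ ∧ ∀ a ∈ I, ψ (a : IndSpace σ →L[ℂ] IndSpace σ) = 0 := by
  obtain ⟨X, _, _, _, _, _, _, _, hX, hfree, ν, -, hν⟩ := hH
  have := hX.nonempty
  obtain ⟨x, hx⟩ := exists_forall_smul_ne hfree
  obtain ⟨φ, hφ, hφI⟩ := exists_isState_of_isProper (inducedRep σ).cstar
    (StarSubalgebra.isClosed_topologicalClosure _) I hI
  have hθ := isCovariant_poissonOp (X := X) σ hν
  obtain ⟨ψ, hψ, hψI, heval⟩ := hθ.exists_isState_eval hX hφ hφI x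
  exact ⟨ψ, hψ, hθ.isTraceOn hψ hx heval, hψI⟩

end IndRep

end

theorem mainTheorem2 {G : Type u} [Group G] [Countable G] (H : Subgroup G)
    (hH : IndRep.IsWeaklyParabolic.{u, v} H)
    {K : Type w} [NormedAddCommGroup K] [InnerProductSpace ℂ K] [CompleteSpace K]
    [Nontrivial K] (σ : IndRep.UnitaryRep H K) :
    ∃ Φ : (IndRep.inducedRep σ).cstar →⋆ₐ[ℂ] (IndRep.regularRep G).cstar,
      (∀ g : G, Φ ((IndRep.inducedRep σ).toCstar g) = (IndRep.regularRep G).toCstar g) ∧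
      Function.Surjective Φ ∧
      IsGreatest {I : TwoSidedIdeal (IndRep.inducedRep σ).cstar |
        IsClosed (I : Set (IndRep.inducedRep σ).cstar) ∧ I ≠ ⊤} (TwoSidedIdeal.ker Φ) := by
  have := IndRep.IndSpace.nontrivial σ
  -- The zero ideal is proper because `E ≠ 0`; the trace state it provides shows that `λ_G` is
  -- weakly contained in `π`.
  obtain ⟨ψ, hψ, htr, -⟩ := hH.exists_trace σ (IndRep.bot_ne_top_cstar _)
  obtain ⟨Φ, hΦ⟩ := IndRep.exists_starAlgHom_regularRep (htr.norm_regularRep_le hψ)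
  exact ⟨Φ, IndRep.map_toCstar hΦ, IndRep.surjective_regularRep hΦ,
    IndRep.isGreatest_ker hΦ fun I hI => hH.exists_trace σ hI⟩
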